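/- Let $M$ be a smooth manifold (without boundary, finite-dimensional) with an almost contact metric structure $(\varphi,\xi,\eta,g)$: $g$ is a Riemannian metric, $\varphi$ a $(1,1)$-tensor field, $\xi$ a vector field and $\eta$ a $1$-form, all smooth, with $\varphi^2=-\mathrm{Id}+\eta\otimes\xi$, $\eta(\xi)=1$ and $g(\varphi X,\varphi Y)=g(X,Y)-\eta(X)\eta(Y)$. Let $\widetilde M=\mathbb R_+\times M$ be the metric cone, with $\widetilde g=dt^2+t^2g$ and the almost complex structure $$J(a\,\partial_t+X)=t\,\eta(X)\,\partial_t+\varphi X-\frac at\,\xi .$$ For a Riemannian metric with Levi-Civita connection $\nabla$ write $R_{XY}Z=\nabla_X\nabla_YZ-\nabla_Y\nabla_XZ-\nabla_{[X,Y]}Z$ and $R(X,Y,Z,W)=-g(R_{XY}Z,W)$; let $\widetilde R$ be the corresponding tensor of $\widetilde g$. Then $(\widetilde M,J,\widetilde g)$ satisfies Gray's identity (K3), i.e. $\widetilde R(A,B,C,D)=\widetilde R(JA,JB,JC,JD)$ for all smooth vector fields $A,B,C,D$ on $\widetilde M$, if and only if $$\begin{aligned}R(X,Y,Z,W)={}&R(\varphi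 X,\varphi Y,\varphi Z,\varphi W)+g(X,Z)\eta(W)\eta(Y)-g(Z,Y)\eta(X)\eta(W)\\&+g(Y,W)\eta(X)\eta(Z)-g(X,W)\eta(Y)\eta(Z)\end{aligned}$$ for all smooth vector fields $X,Y,Z,W$ on $M$. (The latter is called the (G3) identity.) -/

import Mathlib

open scoped Manifold ContDiff

noncomputable section

namespace Gray

/-! ### Levi-Civita connection and curvature of a metric on a vector space

`G` is a metric on (an open piece of) the vector space `V`, i.e. the coordinate expression of a
Riemannian metric, and vector fields are functions `V → V`. -/

section Local

variable {V : Type*} [NormedAddCommGroup V] [NormedSpace ℝ V]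

/-- The one-form `c ↦ ½ (∂_a G(b, c) + ∂_b G(a, c) - ∂_c G(a, b))` at the point `u`
(Christoffel symbols of the first kind). -/
def christoffelForm (G : V → V →L[ℝ] V →L[ℝ] ℝ) (u a b : V) : V →L[ℝ] ℝ :=
  (1 / 2 : ℝ) •
    (fderiv ℝ G u a b + fderiv ℝ G u b a - ((fderiv ℝ G u).flip a).flip b)

/-- The Christoffel symbol `Γ(a, b)` at `u`: the vector representing `christoffelForm G u a b`
through the (nondegenerate) bilinear form `G u`. -/
def christoffel (G : V → V →L[ℝ] V →L[ℝ] ℝ) (u a b : V) : V :=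
  (G u).inverse (christoffelForm G u a b)

/-- The Levi-Civita covariant derivative `∇_X Y = DY(X) + Γ(X, Y)` of the metric `G`. -/
def covDeriv (G : V → V →L[ℝ] V →L[ℝ] ℝ) (X Y : V → V) (u : V) : V :=
  fderiv ℝ Y u (X u) + christoffel G u (X u) (Y u)

/-- The curvature `R_{XY} Z = ∇_X ∇_Y Z - ∇_Y ∇_X Z - ∇_{[X, Y]} Z` of the metric `G`. -/
def curvOp (G : V → V →L[ℝ] V →L[ℝ] ℝ) (X Y Z : V → V) : V → V :=
  covDeriv G X (covDeriv G Y Z) - covDeriv G Y (covDeriv G X Z)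
    - covDeriv G (VectorField.lieBracket ℝ X Y) Z

end Local

/-! ### Curvature of a Riemannian manifold without boundary -/

section Manifolds

variable {E : Type*} [NormedAddCommGroup E] [NormedSpace ℝ E]
  {H : Type*} [TopologicalSpace H] (I : ModelWithCorners ℝ E H)
  {M : Type*} [TopologicalSpace M] [ChartedSpace H M]

/-- `X` is a smooth vector field on `M`. -/
def IsSmoothField [IsManifold I ∞ M] (X : Π x : M, TangentSpace I x) : Prop :=
  ContMDiff I I.tangent ∞ (fun x ↦ (⟨x, X x⟩ : TangentBundle I M))

/-- The inverse of the chart at `x₀`, as a local parametrization of `M` by the model space. -/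
def param (x₀ : M) : E → M := (extChartAt I x₀).symm

/-- The coordinate expression of the metric `g` in the chart at `x₀`:
its pullback by the local parametrization. -/
def metricInChart (g : Π x : M, TangentSpace I x →L[ℝ] TangentSpace I x →L[ℝ] ℝ) (x₀ : M) :
    E → E →L[ℝ] E →L[ℝ] ℝ :=
  fun u ↦
    let D : E →L[ℝ] TangentSpace I (param I x₀ u) := mfderiv 𝓘(ℝ, E) I (param I x₀) u
    (D.precomp ℝ).comp ((g (param I x₀ u)).comp D)

/-- The coordinate expression of the vector field `X` in the chart at `x₀`. -/
def fieldInChart (X : Π x : M, TangentSpace I x) (x₀ : M) : E → E :=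
  VectorField.mpullback 𝓘(ℝ, E) I (param I x₀) X

/-- The curvature `R_{XY} Z` of the Levi-Civita connection of `g`; its value at `x` is computed in
the chart at `x` and carried back to the tangent space of `M` at `x`. -/
def curvature (g : Π x : M, TangentSpace I x →L[ℝ] TangentSpace I x →L[ℝ] ℝ)
    (X Y Z : Π x : M, TangentSpace I x) (x : M) : TangentSpace I x :=
  (mfderiv 𝓘(ℝ, E) I (param I x) (extChartAt I x x) :
      E →L[ℝ] TangentSpace I (param I x (extChartAt I x x)))
    (curvOp (V := E) (metricInChart I g x) (fieldInChart I X x) (fieldInChart I Y x)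
      (fieldInChart I Z x) (extChartAt I x x))

/-- The Riemann-Christoffel curvature tensor `R(X, Y, Z, W) = - g(R_{XY} Z, W)`. -/
def riemann (g : Π x : M, TangentSpace I x →L[ℝ] TangentSpace I x →L[ℝ] ℝ)
    (X Y Z W : Π x : M, TangentSpace I x) (x : M) : ℝ :=
  - g x (curvature I g X Y Z x) (W x)

/-- Gray's identity `(K3)` for the metric `h` and the endomorphism field `J`:
`R(X, Y, Z, W) = R(JX, JY, JZ, JW)` for all smooth vector fields. -/
def IsK3 [IsManifold I ∞ M] (h : Π x : M, TangentSpace I x →L[ℝ] TangentSpace I x →L[ℝ] ℝ)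
    (J : Π x : M, TangentSpace I x →L[ℝ] TangentSpace I x) : Prop :=
  ∀ X Y Z W : Π x : M, TangentSpace I x,
    IsSmoothField I X → IsSmoothField I Y → IsSmoothField I Z → IsSmoothField I W →
    ∀ x : M, riemann I h X Y Z W x =
      riemann I h (fun y ↦ J y (X y)) (fun y ↦ J y (Y y)) (fun y ↦ J y (Z y))
        (fun y ↦ J y (W y)) x

variable (M) in
/-- A smooth almost contact metric structure `(φ, ξ, η, g)` on `M`. -/
structure AlmostContactMetric [IsManifold I ∞ M] where
  /-- the `(1,1)` tensor field -/
  φ : Π x : M, TangentSpace I x →L[ℝ] TangentSpace I x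
  /-- the characteristic vector field -/
  ξ : Π x : M, TangentSpace I x
  /-- the one-form -/
  η : Π x : M, TangentSpace I x →L[ℝ] ℝ
  /-- the Riemannian metric -/
  g : Bundle.ContMDiffRiemannianMetric I ∞ E (fun x : M ↦ TangentSpace I x)
  contMDiff_φ : ContMDiff I (I.prod 𝓘(ℝ, E →L[ℝ] E)) ∞
    (fun x ↦ Bundle.TotalSpace.mk' (E →L[ℝ] E)
      (E := fun x : M ↦ TangentSpace I x →L[ℝ] TangentSpace I x) x (φ x))
  contMDiff_ξ : IsSmoothField I ξ
  contMDiff_η : ContMDiff I (I.prod 𝓘(ℝ, E →L[ℝ] ℝ)) ∞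
    (fun x ↦ Bundle.TotalSpace.mk' (E →L[ℝ] ℝ)
      (E := fun x : M ↦ TangentSpace I x →L[ℝ] ℝ) x (η x))
  φ_φ : ∀ (x : M) (v : TangentSpace I x), φ x (φ x v) = -v + η x v • ξ x
  η_ξ : ∀ x : M, η x (ξ x) = 1
  g_φ_φ : ∀ (x : M) (v w : TangentSpace I x),
    g.inner x (φ x v) (φ x w) = g.inner x v w - η x v * η x w

/-! ### The metric cone -/

/-- The half-line `ℝ₊ = (0, ∞)`, an open submanifold of `ℝ`. -/
abbrev PosLine : TopologicalSpace.Opens ℝ := ⟨Set.Ioi 0, isOpen_Ioi⟩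

variable (M) in
/-- The manifold `ℝ₊ × M` underlying the cone. -/
abbrev Cone : Type _ := PosLine × M

/-- The model with corners of the cone. -/
abbrev coneModel : ModelWithCorners ℝ (ℝ × E) (ModelProd ℝ H) := 𝓘(ℝ, ℝ).prod I

/-- The radial coordinate `t` on the cone. -/
def radius (p : Cone M) : ℝ := (p.1 : ℝ)

/-- The `∂_t`-component of a tangent vector `(a, X)` of the cone. -/
def dt (p : Cone M) : TangentSpace (coneModel I) p →L[ℝ] ℝ :=
  ContinuousLinearMap.fst ℝ ℝ E

/-- The component tangent to `M` of a tangent vector `(a, X)` of the cone. -/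
def proj (p : Cone M) : TangentSpace (coneModel I) p →L[ℝ] TangentSpace I p.2 :=
  ContinuousLinearMap.snd ℝ ℝ E

/-- The tangent vector `a ∂_t + X = (a, X)` of the cone, as a continuous linear map of `a, X`. -/
def mkTangent (p : Cone M) : (ℝ × TangentSpace I p.2) →L[ℝ] TangentSpace (coneModel I) p :=
  ContinuousLinearMap.id ℝ (ℝ × E)

/-- `dt` is the differential of the radial coordinate. -/
theorem mfderiv_radius (p : Cone M) :
    mfderiv (coneModel I) 𝓘(ℝ, ℝ) (radius (M := M)) p = dt I p := by
  have h1 : HasMFDerivAt 𝓘(ℝ, ℝ) 𝓘(ℝ, ℝ) (Subtype.val : PosLine → ℝ) p.1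
      (ContinuousLinearMap.id ℝ ℝ) := by
    refine ⟨continuous_subtype_val.continuousAt, ?_⟩
    have h2 : writtenInExtChartAt 𝓘(ℝ, ℝ) 𝓘(ℝ, ℝ) p.1 (Subtype.val : PosLine → ℝ)
        =ᶠ[nhds (p.1 : ℝ)] id :=
      (TopologicalSpace.Opens.chartAt_subtype_val_symm_eventuallyEq (H := ℝ) PosLine
        (x := p.1)).symm
    exact ((hasFDerivAt_id (𝕜 := ℝ) (p.1 : ℝ)).congr_of_eventuallyEq h2).hasFDerivWithinAt
  have h3 := h1.comp p (hasMFDerivAt_fst (I := 𝓘(ℝ, ℝ)) (I' := I) p)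
  exact h3.mfderiv

/-- `proj` is the differential of the projection of the cone onto `M`. -/
theorem mfderiv_snd_cone (p : Cone M) :
    mfderiv (coneModel I) I (Prod.snd : Cone M → M) p = proj I p :=
  mfderiv_snd

/-- The cone metric `dt² + t² g`. -/
def coneMetric (g : Π x : M, TangentSpace I x →L[ℝ] TangentSpace I x →L[ℝ] ℝ) (p : Cone M) :
    TangentSpace (coneModel I) p →L[ℝ] TangentSpace (coneModel I) p →L[ℝ] ℝ :=
  ((dt I p).precomp ℝ).comp ((ContinuousLinearMap.mul ℝ ℝ).comp (dt I p))
    + radius p ^ 2 • ((proj I p).precomp ℝ).comp ((g p.2).comp (proj I p))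

theorem coneMetric_apply (g : Π x : M, TangentSpace I x →L[ℝ] TangentSpace I x →L[ℝ] ℝ)
    (p : Cone M) (v w : TangentSpace (coneModel I) p) :
    coneMetric I g p v w =
      dt I p v * dt I p w + radius p ^ 2 * g p.2 (proj I p v) (proj I p w) :=
  rfl

variable {I} in
/-- The endomorphism field `J (a, X) = (t η(X), φ X - (a / t) ξ)` on the cone. -/
def AlmostContactMetric.coneJ [IsManifold I ∞ M] (S : AlmostContactMetric I M) (p : Cone M) :
    TangentSpace (coneModel I) p →L[ℝ] TangentSpace (coneModel I) p :=
  (mkTangent I p).comp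
    ((radius p • (S.η p.2).comp (proj I p)).prod
      ((S.φ p.2).comp (proj I p) - ((radius p)⁻¹ • dt I p).smulRight (S.ξ p.2)))

variable {I} in
theorem AlmostContactMetric.coneJ_apply [IsManifold I ∞ M] (S : AlmostContactMetric I M)
    (p : Cone M) (v : TangentSpace (coneModel I) p) :
    S.coneJ p v = mkTangent I p (radius p * S.η p.2 (proj I p v),
      S.φ p.2 (proj I p v) - (dt I p v / radius p) • S.ξ p.2) := by
  rw [div_eq_inv_mul]
  rfl

end Manifolds

end Gray

end

/-! The curvature of the cone lives on the base: `∂_t` annihilates it, and on vectors tangent to `M`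
it is `t²` times `coneForm`, which is the curvature tensor of `g` minus that of a unit sphere:
`R(a,b,c,d) + g(b,c) g(a,d) - g(a,c) g(b,d)`. So (K3) only sees the `M`-components of `A` and `JA`,
which are `X` and `φX - (a/t) ξ`.

Expanding `g(φ·, φ·) = g - η ⊗ η` in the sphere part, the quartic terms in `η` cancel and the
remaining ones are those of (G3). Hence (G3) says exactly that `coneForm` is invariant under `φ`
(`coneForm_φ_iff`). Applying (K3) to fields with no radial component gives this invariance.
Conversely, since `φξ = 0`, invariance forces `coneForm` to vanish whenever one argument is `ξ`. The
terms `(a/t) ξ` in `JA` then contribute nothing, and (K3) follows (`coneForm_sub_smul_ξ`).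

The cone curvature (`riemann_coneMetric`) is computed in charts: Christoffel symbols and curvature
of `ds² + s² G` over a vector space (`curvTensor_localCone`), then transport through the product
chart. Tensoriality (`curvOp_eq_curvTensor`) reduces the curvature of fields to their values at a
point. -/

namespace Gray

set_option maxSynthPendingDepth 3

/-! ### Christoffel symbols and curvature of a metric on a vector space. -/

section LocalCurvature

variable {V : Type*} [NormedAddCommGroup V] [NormedSpace ℝ V]

/-- The first-kind Christoffel symbols, as a continuous trilinear form depending on the
derivative `D` of the metric. -/
noncomputable def christoffelFormL :
    (V →L[ℝ] V →L[ℝ] V →L[ℝ] ℝ) →L[ℝ] (V →L[ℝ] V →L[ℝ] V →L[ℝ] ℝ) :=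
  let f₁ : (V →L[ℝ] V →L[ℝ] V →L[ℝ] ℝ) →L[ℝ] (V →L[ℝ] V →L[ℝ] V →L[ℝ] ℝ) :=
    (ContinuousLinearMap.flipₗᵢ ℝ V V (V →L[ℝ] ℝ)).toContinuousLinearEquiv.toContinuousLinearMap
  let f₂ : (V →L[ℝ] V →L[ℝ] V →L[ℝ] ℝ) →L[ℝ] (V →L[ℝ] V →L[ℝ] V →L[ℝ] ℝ) :=
    ContinuousLinearMap.compL ℝ V (V →L[ℝ] V →L[ℝ] ℝ) (V →L[ℝ] V →L[ℝ] ℝ)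
      (ContinuousLinearMap.flipₗᵢ ℝ V V ℝ).toContinuousLinearEquiv.toContinuousLinearMap
  (1 / 2 : ℝ) • (ContinuousLinearMap.id ℝ _ + f₁ - f₂.comp f₁)

theorem christoffelFormL_apply (G : V → V →L[ℝ] V →L[ℝ] ℝ) (u a b : V) :
    christoffelFormL (fderiv ℝ G u) a b = christoffelForm G u a b := by
  ext c
  simp [christoffelFormL, christoffelForm]

/-- The Christoffel symbols of `G` at `u` as a continuous bilinear map. -/
noncomputable def christoffelL (G : V → V →L[ℝ] V →L[ℝ] ℝ) (u : V) : V →L[ℝ] V →L[ℝ] V :=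
  (ContinuousLinearMap.compL ℝ V (V →L[ℝ] ℝ) V (G u).inverse).comp
    (christoffelFormL (fderiv ℝ G u))

theorem christoffelL_apply (G : V → V →L[ℝ] V →L[ℝ] ℝ) (u a b : V) :
    christoffelL G u a b = christoffel G u a b := by
  simp [christoffelL, christoffel, ← christoffelFormL_apply]

/-- One derivative is lost to `fderiv ℝ G`; inversion of operators is smooth at an invertible one.
-/
theorem contDiffAt_christoffelL [CompleteSpace V] {G : V → V →L[ℝ] V →L[ℝ] ℝ} {u : V}
    (hG : ContDiffAt ℝ 2 G u) (hu : (G u).IsInvertible) :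
    ContDiffAt ℝ 1 (christoffelL G) u := by
  have h₁ : ContDiffAt ℝ 1 (fun v ↦ (G v).inverse) u :=
    (hu.contDiffAt_map_inverse (n := 1)).comp u (hG.of_le (by norm_num))
  have h₂ : ContDiffAt ℝ 1 (fderiv ℝ G) u := hG.fderiv_right (by norm_num)
  exact ((ContinuousLinearMap.contDiff _).contDiffAt.comp u h₁).clm_comp
    ((ContinuousLinearMap.contDiff _).contDiffAt.comp u h₂)

/-- The curvature of `G` at `u`, expressed by the Christoffel symbols. -/
noncomputable def curvTensor (G : V → V →L[ℝ] V →L[ℝ] ℝ) (u a b c : V) : V :=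
  fderiv ℝ (christoffelL G) u a b c - fderiv ℝ (christoffelL G) u b a c
    + christoffelL G u a (christoffelL G u b c) - christoffelL G u b (christoffelL G u a c)

theorem fderiv_covDeriv {G : V → V →L[ℝ] V →L[ℝ] ℝ} {Y Z : V → V} {u : V}
    (hΓ : DifferentiableAt ℝ (christoffelL G) u) (hY : DifferentiableAt ℝ Y u)
    (hZ : ContDiffAt ℝ 2 Z u) (a : V) :
    fderiv ℝ (covDeriv G Y Z) u a =
      fderiv ℝ (fderiv ℝ Z) u a (Y u) + fderiv ℝ Z u (fderiv ℝ Y u a)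
        + (fderiv ℝ (christoffelL G) u a (Y u) (Z u)
          + christoffelL G u (fderiv ℝ Y u a) (Z u)
          + christoffelL G u (Y u) (fderiv ℝ Z u a)) := by
  have hZ' : DifferentiableAt ℝ (fderiv ℝ Z) u :=
    (hZ.fderiv_right (m := 1) (by norm_num)).differentiableAt (by norm_num)
  have hZ'' : DifferentiableAt ℝ Z u := hZ.differentiableAt (by norm_num)
  have h := (hZ'.hasFDerivAt.clm_apply hY.hasFDerivAt).add
    ((hΓ.hasFDerivAt.clm_apply hY.hasFDerivAt).clm_apply hZ''.hasFDerivAt)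
  have heq : covDeriv G Y Z =
      (fun v ↦ fderiv ℝ Z v (Y v)) + fun v ↦ christoffelL G v (Y v) (Z v) := by
    ext v; simp [covDeriv, christoffelL_apply]
  rw [heq, h.fderiv]
  simp
  abel

/-- The curvature operator is tensorial. -/
theorem curvOp_eq_curvTensor {G : V → V →L[ℝ] V →L[ℝ] ℝ} {X Y Z : V → V} {u : V}
    (hΓ : DifferentiableAt ℝ (christoffelL G) u) (hX : DifferentiableAt ℝ X u)
    (hY : DifferentiableAt ℝ Y u) (hZ : ContDiffAt ℝ 2 Z u) :
    curvOp G X Y Z u = curvTensor G u (X u) (Y u) (Z u) := by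
  -- This symmetry cancels the second derivatives of `Z`. Derivatives of `X` and `Y` are absorbed by
  -- the bracket, and the terms `Γ(X, DZ(Y)) + Γ(Y, DZ(X))` are symmetric in `X`, `Y`, so they drop
  -- out of the commutator.
  have hs : IsSymmSndFDerivAt ℝ Z u := hZ.isSymmSndFDerivAt (by simp)
  have h (W : V → V) (W' : V → V) : covDeriv G W W' u =
      fderiv ℝ W' u (W u) + christoffelL G u (W u) (W' u) := by
    rw [christoffelL_apply]; rfl
  simp only [curvOp, Pi.sub_apply, h, fderiv_covDeriv hΓ hX hZ,
    fderiv_covDeriv hΓ hY hZ, VectorField.lieBracket, curvTensor, map_sub, map_add,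
    sub_apply, hs.eq (X u) (Y u)]
  abel

theorem christoffelL_congr {G G' : V → V →L[ℝ] V →L[ℝ] ℝ} {u : V} (h : G =ᶠ[nhds u] G') :
    christoffelL G =ᶠ[nhds u] christoffelL G' := by
  filter_upwards [h, h.fderiv (𝕜 := ℝ)] with v h₁ h₂
  simp only [christoffelL, h₁, h₂]

theorem curvTensor_congr {G G' : V → V →L[ℝ] V →L[ℝ] ℝ} {u : V} (h : G =ᶠ[nhds u] G') :
    curvTensor G u = curvTensor G' u := by
  have h' := christoffelL_congr h
  ext a b c
  simp only [curvTensor, h'.fderiv_eq, h'.eq_of_nhds]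

theorem christoffel_spec {G : V → V →L[ℝ] V →L[ℝ] ℝ} {u : V} (hu : (G u).IsInvertible)
    (a b c : V) : G u (christoffelL G u a b) c = christoffelForm G u a b c := by
  rw [christoffelL_apply, christoffel, hu.self_apply_inverse]

theorem christoffelL_eq_of {G : V → V →L[ℝ] V →L[ℝ] ℝ} {u : V} (hu : (G u).IsInvertible)
    {a b d : V} (h : ∀ c, G u d c = christoffelForm G u a b c) : christoffelL G u a b = d := by
  have h' : christoffelForm G u a b = G u d := by ext c; exact (h c).symm
  rw [christoffelL_apply, christoffel, h', hu.inverse_apply_self]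

theorem fderiv_apply_apply {G : V → V →L[ℝ] V →L[ℝ] ℝ} {u : V} (hG : DifferentiableAt ℝ G u)
    (a b c : V) : fderiv ℝ (fun v ↦ G v b c) u a = fderiv ℝ G u a b c := by
  rw [((hG.hasFDerivAt.clm_apply (hasFDerivAt_const b u)).clm_apply
    (hasFDerivAt_const c u)).fderiv]
  simp

end LocalCurvature

/-! ### The cone over a metric on a vector space. -/

section LocalCone

variable {V : Type*} [NormedAddCommGroup V] [NormedSpace ℝ V]

theorem isInvertible_of_nondegenerate [FiniteDimensional ℝ V] {B : V →L[ℝ] V →L[ℝ] ℝ}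
    (h : ∀ v, (∀ w, B v w = 0) → v = 0) : B.IsInvertible := by
  have hinj : Function.Injective (B : V →ₗ[ℝ] V →L[ℝ] ℝ) := by
    rw [injective_iff_map_eq_zero]
    intro v hv
    exact h v fun w ↦ by simpa using DFunLike.congr_fun hv w
  have hrank : Module.finrank ℝ V = Module.finrank ℝ (V →L[ℝ] ℝ) := by
    rw [← Subspace.dual_finrank_eq]
    exact (LinearMap.toContinuousLinearMap (𝕜 := ℝ) (E := V) (F' := ℝ)).finrank_eq
  exact ⟨(LinearEquiv.ofInjectiveOfFinrankEq (B : V →ₗ[ℝ] V →L[ℝ] ℝ) hinj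
    hrank).toContinuousLinearEquiv, by ext; rfl⟩

/-- The cone metric `ds² + s² G` over the metric `G` on a vector space. -/
noncomputable def localCone (G : V → V →L[ℝ] V →L[ℝ] ℝ) (p : ℝ × V) :
    (ℝ × V) →L[ℝ] (ℝ × V) →L[ℝ] ℝ :=
  ((ContinuousLinearMap.fst ℝ ℝ V).precomp ℝ).comp
      ((ContinuousLinearMap.mul ℝ ℝ).comp (ContinuousLinearMap.fst ℝ ℝ V))
    + p.1 ^ 2 • ((ContinuousLinearMap.snd ℝ ℝ V).precomp ℝ).comp
        ((G p.2).comp (ContinuousLinearMap.snd ℝ ℝ V))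

theorem localCone_apply (G : V → V →L[ℝ] V →L[ℝ] ℝ) (p A B : ℝ × V) :
    localCone G p A B = A.1 * B.1 + p.1 ^ 2 * G p.2 A.2 B.2 := rfl

variable {G : V → V →L[ℝ] V →L[ℝ] ℝ}

theorem contDiffAt_localCone {p : ℝ × V} (hG : ContDiffAt ℝ 2 G p.2) :
    ContDiffAt ℝ 2 (localCone G) p := by
  have h : ContDiffAt ℝ 2 (fun q : ℝ × V ↦ G q.2) p := hG.comp p contDiffAt_snd
  refine contDiffAt_const.add ((contDiffAt_fst.pow 2).smul ?_)
  exact contDiffAt_const.clm_comp (h.clm_comp contDiffAt_const)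

theorem isInvertible_localCone [FiniteDimensional ℝ V] {p : ℝ × V} (hp : p.1 ≠ 0)
    (hu : (G p.2).IsInvertible) : (localCone G p).IsInvertible := by
  refine isInvertible_of_nondegenerate fun A hA ↦ ?_
  have h₁ : A.1 = 0 := by simpa [localCone_apply] using hA (1, 0)
  have h₂ : G p.2 A.2 = 0 := by
    ext z
    simpa [localCone_apply, hp] using hA (0, z)
  exact Prod.ext h₁ (hu.injective (by simpa using h₂))

theorem fderiv_localCone {p : ℝ × V} (hG : DifferentiableAt ℝ G p.2)
    (hG' : DifferentiableAt ℝ (localCone G) p) (A B C : ℝ × V) :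
    fderiv ℝ (localCone G) p A B C =
      2 * p.1 * A.1 * G p.2 B.2 C.2 + p.1 ^ 2 * fderiv ℝ G p.2 A.2 B.2 C.2 := by
  have h₁ : HasFDerivAt (fun q : ℝ × V ↦ G q.2 B.2 C.2) _ p :=
    (((hG.hasFDerivAt.comp p hasFDerivAt_snd).clm_apply (hasFDerivAt_const B.2 p)).clm_apply
      (hasFDerivAt_const C.2 p))
  have h₂ := ((((hasFDerivAt_fst (𝕜 := ℝ) (p := p)).pow 2).mul h₁).const_add (B.1 * C.1))
  rw [← fderiv_apply_apply hG']
  simp only [localCone_apply]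
  refine (DFunLike.congr_fun h₂.fderiv A).trans ?_
  simp
  ring

/-- Classically `∇_X Y` acquires the radial part `-t g(X,Y) ∂_t`, and `∇_X ∂_t = X / t`. By
nondegeneracy it suffices to test the candidate against the form defining the Christoffel symbol. -/
theorem christoffelL_localCone [FiniteDimensional ℝ V] {p : ℝ × V} (hp : p.1 ≠ 0)
    (hG : ContDiffAt ℝ 2 G p.2) (hu : (G p.2).IsInvertible) (A B : ℝ × V) :
    christoffelL (localCone G) p A B =
      (-p.1 * G p.2 A.2 B.2,
        christoffelL G p.2 A.2 B.2 + ((A.1 / p.1) • B.2 + (B.1 / p.1) • A.2)) := by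
  refine christoffelL_eq_of (isInvertible_localCone hp hu) fun C ↦ ?_
  have hd := (contDiffAt_localCone (p := p) hG).differentiableAt (by norm_num)
  have hd' := hG.differentiableAt (by norm_num)
  rw [localCone_apply]
  simp only [map_add, map_smul, add_apply, smul_apply, smul_eq_mul,
    christoffel_spec hu, christoffelForm, sub_apply, ContinuousLinearMap.flip_apply,
    fderiv_localCone hd' hd]
  field_simp
  ring

theorem fderiv_symm {u : V} (hG : DifferentiableAt ℝ G u)
    (hsymm : ∀ᶠ v in nhds u, ∀ a b, G v a b = G v b a) (a b c : V) :
    fderiv ℝ G u a b c = fderiv ℝ G u a c b := by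
  rw [← fderiv_apply_apply hG, ← fderiv_apply_apply hG]
  have : (fun v ↦ G v b c) =ᶠ[nhds u] fun v ↦ G v c b := by
    filter_upwards [hsymm] with v hv using hv b c
  rw [this.fderiv_eq]

theorem christoffelL_symm {u : V} (hG : DifferentiableAt ℝ G u) (hu : (G u).IsInvertible)
    (hsymm : ∀ᶠ v in nhds u, ∀ a b, G v a b = G v b a) (a b : V) :
    christoffelL G u a b = christoffelL G u b a := by
  refine christoffelL_eq_of hu fun c ↦ ?_
  rw [christoffel_spec hu]
  simp only [christoffelForm, smul_apply, add_apply, sub_apply, ContinuousLinearMap.flip_apply,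
    fderiv_symm hG hsymm c a b]
  ring

theorem fderiv_christoffelL_localCone [FiniteDimensional ℝ V] {p : ℝ × V} (hp : p.1 ≠ 0)
    (hG : ContDiffAt ℝ 2 G p.2) (hu : ∀ᶠ v in nhds p.2, (G v).IsInvertible)
    (A B C : ℝ × V) :
    fderiv ℝ (christoffelL (localCone G)) p A B C =
      (-A.1 * G p.2 B.2 C.2 - p.1 * fderiv ℝ G p.2 A.2 B.2 C.2,
        fderiv ℝ (christoffelL G) p.2 A.2 B.2 C.2
          - (A.1 * B.1 / p.1 ^ 2) • C.2 - (A.1 * C.1 / p.1 ^ 2) • B.2) := by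
  have := FiniteDimensional.complete ℝ V
  have hΓ : DifferentiableAt ℝ (christoffelL (localCone G)) p :=
    (contDiffAt_christoffelL (contDiffAt_localCone hG)
      (isInvertible_localCone hp hu.self_of_nhds)).differentiableAt (by norm_num)
  have hΓ' : DifferentiableAt ℝ (christoffelL G) p.2 :=
    (contDiffAt_christoffelL hG hu.self_of_nhds).differentiableAt (by norm_num)
  -- The closed formula is differentiated, so it must hold on a neighbourhood of `p` and not only at
  -- `p`.
  have heq : (fun q ↦ christoffelL (localCone G) q B C) =ᶠ[nhds p] fun q ↦
      (-q.1 * G q.2 B.2 C.2,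
        christoffelL G q.2 B.2 C.2 + ((B.1 * q.1⁻¹) • C.2 + (C.1 * q.1⁻¹) • B.2)) := by
    have hsnd : Filter.Tendsto (Prod.snd : ℝ × V → V) (nhds p) (nhds p.2) :=
      continuous_snd.continuousAt
    have hG' : ∀ᶠ v in nhds p.2, ContDiffAt ℝ 2 G v := hG.eventually (by simp)
    have hp' : ∀ᶠ q in nhds p, q.1 ≠ 0 := continuous_fst.continuousAt.eventually_ne hp
    filter_upwards [hp', hsnd.eventually hu, hsnd.eventually hG']
      with q h₁ h₂ h₄
    rw [christoffelL_localCone h₁ h₄ h₂]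
    simp [div_eq_mul_inv]
  have h₁ : fderiv ℝ (fun q ↦ christoffelL (localCone G) q B C) p A =
      fderiv ℝ (christoffelL (localCone G)) p A B C := by
    rw [((hΓ.hasFDerivAt.clm_apply (hasFDerivAt_const B p)).clm_apply
      (hasFDerivAt_const C p)).fderiv]
    simp
  rw [← h₁, heq.fderiv_eq]
  have hinv : HasFDerivAt (fun q : ℝ × V ↦ q.1⁻¹) _ p :=
    (hasDerivAt_inv hp).comp_hasFDerivAt p (hasFDerivAt_fst (𝕜 := ℝ) (p := p))
  have hGd : HasFDerivAt (fun q : ℝ × V ↦ G q.2 B.2 C.2) _ p :=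
    ((((hG.differentiableAt (by norm_num)).hasFDerivAt.comp p hasFDerivAt_snd).clm_apply
      (hasFDerivAt_const B.2 p)).clm_apply (hasFDerivAt_const C.2 p))
  have hΓd : HasFDerivAt (fun q : ℝ × V ↦ christoffelL G q.2 B.2 C.2) _ p :=
    (((hΓ'.hasFDerivAt.comp p hasFDerivAt_snd).clm_apply
      (hasFDerivAt_const B.2 p)).clm_apply (hasFDerivAt_const C.2 p))
  have hfirst := ((hasFDerivAt_fst (𝕜 := ℝ) (p := p)).neg.mul hGd)
  have hsecond := hΓd.add (((hinv.const_mul B.1).smul_const C.2).add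
    ((hinv.const_mul C.1).smul_const B.2))
  have h := hfirst.prodMk hsecond
  refine (DFunLike.congr_fun h.fderiv A).trans ?_
  ext
  · simp
    ring
  · simp
    module

/-- The curvature of the cone metric. -/
theorem curvTensor_localCone [FiniteDimensional ℝ V] {p : ℝ × V} (hp : p.1 ≠ 0)
    (hG : ContDiffAt ℝ 2 G p.2) (hu : ∀ᶠ v in nhds p.2, (G v).IsInvertible)
    (hsymm : ∀ᶠ v in nhds p.2, ∀ a b, G v a b = G v b a) (A B C : ℝ × V) :
    curvTensor (localCone G) p A B C =
      (0, curvTensor G p.2 A.2 B.2 C.2 - G p.2 B.2 C.2 • A.2 + G p.2 A.2 C.2 • B.2) := by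
  have hd := hG.differentiableAt (by norm_num)
  have hΓ := fun A B ↦ christoffelL_localCone hp hG hu.self_of_nhds A B
  have hΓs := christoffelL_symm hd hu.self_of_nhds hsymm
  have hDs := fderiv_symm hd hsymm
  have hs := hsymm.self_of_nhds
  simp only [curvTensor, fderiv_christoffelL_localCone hp hG hu, hΓ]
  ext
  -- In the radial component, `christoffel_spec` turns each `G(·, Γ(·,·))` into first derivatives of
  -- `G`, which cancel against those coming from the derivative of `-t G`.
  · simp only [Prod.fst_add, Prod.fst_sub, map_add, map_smul, smul_eq_mul,
      hs _ (christoffelL G _ _ _), christoffel_spec hu.self_of_nhds, christoffelForm,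
      smul_apply, add_apply, sub_apply, ContinuousLinearMap.flip_apply]
    rw [hs B.2 A.2, hDs C.2 B.2 A.2, hDs A.2 C.2 B.2, hDs B.2 C.2 A.2]
    field_simp
    ring
  · simp only [Prod.snd_add, Prod.snd_sub, map_add, map_smul]
    rw [hΓs B.2 A.2]
    match_scalars <;> field_simp <;> ring

end LocalCone

/-! ### Fields, metric and curvature read in a chart. -/

section Charts

variable {E : Type*} [NormedAddCommGroup E] [NormedSpace ℝ E]
  {H : Type*} [TopologicalSpace H] {I : ModelWithCorners ℝ E H}
  {M : Type*} [TopologicalSpace M] [ChartedSpace H M]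

theorem contMDiffOn_param [IsManifold I ∞ M] (x : M) :
    ContMDiffOn 𝓘(ℝ, E) I ∞ (param I x) (extChartAt I x).target :=
  contMDiffOn_extChartAt_symm x

theorem contMDiffAt_param [I.Boundaryless] [IsManifold I ∞ M] {x : M} {u : E} (hu : u ∈ (extChartAt I x).target) :
    ContMDiffAt 𝓘(ℝ, E) I ∞ (param I x) u :=
  (contMDiffOn_param x).contMDiffAt ((isOpen_extChartAt_target x).mem_nhds hu)

theorem isInvertible_mfderiv_param [I.Boundaryless] [IsManifold I ∞ M] {x : M} {u : E} (hu : u ∈ (extChartAt I x).target) :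
    (mfderiv 𝓘(ℝ, E) I (param I x) u).IsInvertible := by
  have := IsManifold.of_le (I := I) (M := M) (m := 1) (n := ∞) (by simp)
  have h := isInvertible_mfderivWithin_extChartAt_symm (I := I) hu
  rwa [I.range_eq_univ, mfderivWithin_univ] at h

theorem mfderiv_param_fieldInChart [I.Boundaryless] [IsManifold I ∞ M] {x : M} {u : E} (hu : u ∈ (extChartAt I x).target)
    (X : Π x : M, TangentSpace I x) :
    mfderiv 𝓘(ℝ, E) I (param I x) u (fieldInChart (E := E) I X x u) = X (param I x u) :=
  (isInvertible_mfderiv_param hu).self_apply_inverse _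

theorem contDiffAt_fieldInChart [I.Boundaryless] [IsManifold I ∞ M] [CompleteSpace E] {x : M} {u : E}
    (hu : u ∈ (extChartAt I x).target) {X : Π x : M, TangentSpace I x} (hX : IsSmoothField I X) :
    ContDiffAt ℝ ∞ (fieldInChart I X x) u := by
  have := IsManifold.of_le (I := I) (M := M) (m := 1) (n := ∞) (by simp)
  refine contMDiffAt_vectorSpace_iff_contDiffAt.1 ?_
  exact ContMDiffAt.mpullback_vectorField_preimage (hX _) (contMDiffAt_param hu)
    (isInvertible_mfderiv_param hu) (by simp)

/-- The section is the image of the constant field `a` under the tangent map of the parametrization.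
-/
theorem contMDiffAt_mfderiv_param [I.Boundaryless] [IsManifold I ∞ M] {x : M} {u : E} (hu : u ∈ (extChartAt I x).target) (a : E) :
    ContMDiffAt 𝓘(ℝ, E) I.tangent ∞ (fun v ↦ (⟨param I x v,
      (mfderiv 𝓘(ℝ, E) I (param I x) v : E →L[ℝ] TangentSpace I (param I x v)) a⟩ :
        TangentBundle I M)) u := by
  have := IsManifold.of_le (I := I) (M := M) (m := 1) (n := ∞) (by simp)
  have hopen := isOpen_extChartAt_target (I := I) x
  have h := (contMDiffOn_param (I := I) x).contMDiffOn_tangentMapWithin (m := ∞) (by simp)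
    hopen.uniqueMDiffOn
  have ha : ContMDiffAt 𝓘(ℝ, E) 𝓘(ℝ, E).tangent ∞
      (fun v : E ↦ (⟨v, a⟩ : TangentBundle 𝓘(ℝ, E) E)) u :=
    contMDiffAt_vectorSpace_iff_contDiffAt.2 contDiffAt_const
  have hmem : (Bundle.TotalSpace.proj ⁻¹' (extChartAt I x).target :
      Set (TangentBundle 𝓘(ℝ, E) E)) ∈ nhds (⟨u, a⟩ : TangentBundle 𝓘(ℝ, E) E) :=
    (hopen.preimage (FiberBundle.continuous_proj E (TangentSpace 𝓘(ℝ, E)))).mem_nhds hu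
  have h' := (h.contMDiffAt hmem).comp u ha
  refine h'.congr_of_eventuallyEq ?_
  filter_upwards [hopen.mem_nhds hu] with v hv
  simp only [tangentMapWithin, Function.comp_apply, mfderivWithin_of_isOpen hopen hv]

theorem contDiffAt_metricInChart [I.Boundaryless] [IsManifold I ∞ M] [FiniteDimensional ℝ E]
    (g : Bundle.ContMDiffRiemannianMetric I ∞ E (fun x : M ↦ TangentSpace I x)) {x : M} {u : E}
    (hu : u ∈ (extChartAt I x).target) : ContDiffAt ℝ ∞ (metricInChart I g.inner x) u := by
  have hopen := isOpen_extChartAt_target (I := I) x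
  suffices h : ContDiffOn ℝ ∞ (metricInChart I g.inner x) (extChartAt I x).target from
    h.contDiffAt (hopen.mem_nhds hu)
  -- In finite dimension, smoothness of an operator-valued map can be tested entry by entry.
  refine contDiffOn_clm_apply.2 fun a ↦ contDiffOn_clm_apply.2 fun b v hv ↦ ?_
  refine ContDiffAt.contDiffWithinAt ?_
  rw [← contMDiffAt_iff_contDiffAt]
  have : ContMDiffAt 𝓘(ℝ, E) (I.prod 𝓘(ℝ)) ∞
      (fun w ↦ Bundle.TotalSpace.mk' ℝ (E := Bundle.Trivial M ℝ) (param I x w)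
        (g.inner (param I x w) (mfderiv 𝓘(ℝ, E) I (param I x) w a)
          (mfderiv 𝓘(ℝ, E) I (param I x) w b))) v := by
    apply ContMDiffAt.clm_bundle_apply₂ (F₁ := E) (F₂ := E)
    · exact g.contMDiff.contMDiffAt.comp v (contMDiffAt_param hv)
    · exact contMDiffAt_mfderiv_param hv a
    · exact contMDiffAt_mfderiv_param hv b
  simp only [Bundle.contMDiffAt_totalSpace] at this
  exact this.2

theorem metricInChart_symm [IsManifold I ∞ M]
    (g : Bundle.ContMDiffRiemannianMetric I ∞ E (fun x : M ↦ TangentSpace I x)) (x : M)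
    (u a b : E) : metricInChart I g.inner x u a b = metricInChart I g.inner x u b a :=
  g.symm _ _ _

theorem isInvertible_metricInChart [I.Boundaryless] [IsManifold I ∞ M] [FiniteDimensional ℝ E]
    (g : Bundle.ContMDiffRiemannianMetric I ∞ E (fun x : M ↦ TangentSpace I x)) {x : M} {u : E}
    (hu : u ∈ (extChartAt I x).target) : (metricInChart I g.inner x u).IsInvertible := by
  refine isInvertible_of_nondegenerate fun a ha ↦ ?_
  by_contra h
  refine (g.pos (param I x u) (mfderiv 𝓘(ℝ, E) I (param I x) u a) fun h0 ↦ h ?_).ne' (ha a)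
  exact (isInvertible_mfderiv_param hu).injective (h0.trans (map_zero _).symm)

variable (I) in
/-- The differential at the base point of the local parametrization of `M` at `x`. -/
noncomputable def chartFrame (x : M) : E →L[ℝ] TangentSpace I x :=
  (mfderiv 𝓘(ℝ, E) I (param I x) (extChartAt I x x) :
    E →L[ℝ] TangentSpace I (param I x (extChartAt I x x)))

theorem isInvertible_chartFrame [I.Boundaryless] [IsManifold I ∞ M] (x : M) : (chartFrame I x).IsInvertible :=
  isInvertible_mfderiv_param (mem_extChartAt_target x)

theorem param_extChartAt (x : M) : param I x (extChartAt I x x) = x :=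
  extChartAt_to_inv x

theorem chartFrame_fieldInChart [I.Boundaryless] [IsManifold I ∞ M] (x : M) (X : Π x : M, TangentSpace I x) :
    chartFrame I x (fieldInChart I X x (extChartAt I x x)) = X x := by
  refine (mfderiv_param_fieldInChart (mem_extChartAt_target x) X).trans ?_
  -- The two base points agree only propositionally, but every tangent space is `E` by definition;
  -- generalizing the point to `y` allows substitution.
  have h : ∀ y : M, y = x → (X y : E) = X x := fun y hy ↦ by subst hy; rfl
  exact h _ (param_extChartAt x)

theorem fieldInChart_extChartAt [I.Boundaryless] [IsManifold I ∞ M] (x : M) (X : Π x : M, TangentSpace I x) :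
    fieldInChart I X x (extChartAt I x x) = (chartFrame I x).inverse (X x) := by
  rw [← chartFrame_fieldInChart x X, (isInvertible_chartFrame x).inverse_apply_self]

theorem metricInChart_extChartAt
    (g : Π x : M, TangentSpace I x →L[ℝ] TangentSpace I x →L[ℝ] ℝ) (x : M) (a b : E) :
    metricInChart I g x (extChartAt I x x) a b = g x (chartFrame I x a) (chartFrame I x b) := by
  have h : ∀ y : M, y = x → ∀ v w : E, g y v w = g x v w := fun y hy ↦ by subst hy; simp
  exact h _ (param_extChartAt x) _ _

variable (I) in
/-- The curvature tensor of `g` as a quadrilinear form on the tangent space at `x`. -/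
noncomputable def curvForm (g : Π x : M, TangentSpace I x →L[ℝ] TangentSpace I x →L[ℝ] ℝ) (x : M)
    (a b c d : TangentSpace I x) : ℝ :=
  - g x (chartFrame I x (curvTensor (metricInChart I g x) (extChartAt I x x)
    ((chartFrame I x).inverse a) ((chartFrame I x).inverse b) ((chartFrame I x).inverse c))) d

theorem riemann_eq_curvForm [I.Boundaryless] [IsManifold I ∞ M] [CompleteSpace E]
    {g : Π x : M, TangentSpace I x →L[ℝ] TangentSpace I x →L[ℝ] ℝ}
    {X Y Z : Π x : M, TangentSpace I x} (W : Π x : M, TangentSpace I x) {x : M}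
    (hg : ContDiffAt ℝ 2 (metricInChart I g x) (extChartAt I x x))
    (hinv : (metricInChart I g x (extChartAt I x x)).IsInvertible)
    (hX : IsSmoothField I X) (hY : IsSmoothField I Y) (hZ : IsSmoothField I Z) :
    riemann I g X Y Z W x = curvForm I g x (X x) (Y x) (Z x) (W x) := by
  have hΓ := (contDiffAt_christoffelL hg hinv).differentiableAt (by norm_num)
  have hf {X : Π x : M, TangentSpace I x} (hX : IsSmoothField I X) :=
    contDiffAt_fieldInChart (mem_extChartAt_target x) hX
  have h := curvOp_eq_curvTensor hΓ ((hf hX).differentiableAt (by simp))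
    ((hf hY).differentiableAt (by simp)) ((hf hZ).of_le (WithTop.coe_le_coe.2 le_top))
  simp only [fieldInChart_extChartAt] at h
  rw [riemann, curvature, h, curvForm]
  rfl

variable (I) in
/-- The curvature tensor of the cone metric over `g`, up to a power of the radius, as a
quadrilinear form on the tangent space of the base. -/
noncomputable def coneForm (g : Π x : M, TangentSpace I x →L[ℝ] TangentSpace I x →L[ℝ] ℝ) (x : M)
    (a b c d : TangentSpace I x) : ℝ :=
  curvForm I g x a b c d + g x b c * g x a d - g x a c * g x b d

section Multilinear

variable (g : Π x : M, TangentSpace I x →L[ℝ] TangentSpace I x →L[ℝ] ℝ) (x : M) (r : ℝ)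
  (a a' b b' c c' d d' : TangentSpace I x)

/-- The shape `a - r • a'` is that of the `M`-component of `J`. Taking `r = 1` and zero vectors also
yields vanishing at `0`. -/
theorem coneForm_sub_smul₁ : coneForm I g x (a - r • a') b c d =
    coneForm I g x a b c d - r * coneForm I g x a' b c d := by
  simp only [coneForm, curvForm, curvTensor, map_add, map_sub, map_smul, sub_apply, add_apply,
    smul_apply, smul_eq_mul]
  ring

theorem coneForm_zero₁ : coneForm I g x 0 b c d = 0 := by
  simpa using coneForm_sub_smul₁ g x 1 0 0 b c d

theorem coneForm_sub_smul₂ : coneForm I g x a (b - r • b') c d =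
    coneForm I g x a b c d - r * coneForm I g x a b' c d := by
  simp only [coneForm, curvForm, curvTensor, map_add, map_sub, map_smul, sub_apply, add_apply,
    smul_apply, smul_eq_mul]
  ring

theorem coneForm_zero₂ : coneForm I g x a 0 c d = 0 := by
  simpa using coneForm_sub_smul₂ g x 1 a 0 0 c d

theorem coneForm_sub_smul₃ : coneForm I g x a b (c - r • c') d =
    coneForm I g x a b c d - r * coneForm I g x a b c' d := by
  simp only [coneForm, curvForm, curvTensor, map_add, map_sub, map_smul, sub_apply, add_apply,
    smul_apply, smul_eq_mul]
  ring

theorem coneForm_zero₃ : coneForm I g x a b 0 d = 0 := by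
  simpa using coneForm_sub_smul₃ g x 1 a b 0 0 d

theorem coneForm_sub_smul₄ : coneForm I g x a b c (d - r • d') =
    coneForm I g x a b c d - r * coneForm I g x a b c d' := by
  simp only [coneForm, curvForm, curvTensor, map_add, map_sub, map_smul, sub_apply, add_apply,
    smul_eq_mul]
  ring

theorem coneForm_zero₄ : coneForm I g x a b c 0 = 0 := by
  simpa using coneForm_sub_smul₄ g x 1 a b c 0 0

end Multilinear

end Charts

/-! ### The curvature of the metric cone. -/

section ConeCurvature

variable {E : Type*} [NormedAddCommGroup E] [NormedSpace ℝ E]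
  {H : Type*} [TopologicalSpace H] {I : ModelWithCorners ℝ E H}
  {M : Type*} [TopologicalSpace M] [ChartedSpace H M]

theorem extChartAt_cone (p : Cone M) :
    extChartAt (coneModel I) p p = ((p.1 : ℝ), extChartAt I p.2 p.2) := by
  rw [extChartAt_prod]
  rfl

theorem snd_param_cone (p : Cone M) (q : ℝ × E) :
    (param (coneModel I) p q).2 = param I p.2 q.2 := by
  simp only [param, extChartAt_prod]
  rfl

/-- The inverse chart of the open submanifold `PosLine` is the identity only on positive reals, so
the equality is local. A germ suffices, as curvature depends only on the germ of the metric. -/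
theorem radius_param_cone (p : Cone M) :
    ∀ᶠ q in nhds (extChartAt (coneModel I) p p), radius (param (coneModel I) p q) = q.1 := by
  have h : ∀ᶠ s in nhds (p.1 : ℝ), s = ((chartAt ℝ p.1).symm s : ℝ) :=
    TopologicalSpace.Opens.chartAt_subtype_val_symm_eventuallyEq (H := ℝ) PosLine (x := p.1)
  rw [extChartAt_cone]
  filter_upwards [(continuous_fst (X := ℝ) (Y := E)).continuousAt.eventually h] with q hq
  simp only [param, extChartAt_prod, radius]
  exact hq.symm

theorem mem_target_of_mem_target_cone {p : Cone M} {q : ℝ × E}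
    (hq : q ∈ (extChartAt (coneModel I) p).target) : q.2 ∈ (extChartAt I p.2).target := by
  rw [extChartAt_prod] at hq
  exact hq.2

variable [I.Boundaryless] [IsManifold I ∞ M]

theorem proj_mfderiv_param_cone {p : Cone M} {q : ℝ × E}
    (hq : q ∈ (extChartAt (coneModel I) p).target) (A : ℝ × E) :
    proj I (param (coneModel I) p q)
        (mfderiv 𝓘(ℝ, ℝ × E) (coneModel I) (param (coneModel I) p) q A) =
      (mfderiv 𝓘(ℝ, E) I (param I p.2) q.2 A.2 : E) := by
  have h₁ : mfderiv 𝓘(ℝ, ℝ × E) I (fun q ↦ (param (coneModel I) p q).2) q =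
      (proj I (param (coneModel I) p q)).comp
        (mfderiv 𝓘(ℝ, ℝ × E) (coneModel I) (param (coneModel I) p) q) := by
    rw [← mfderiv_snd_cone]
    exact mfderiv_comp q mdifferentiableAt_snd
      ((contMDiffAt_param hq).mdifferentiableAt (by simp))
  have h₂ : mfderiv 𝓘(ℝ, ℝ × E) I (fun q : ℝ × E ↦ param I p.2 q.2) q =
      (mfderiv 𝓘(ℝ, E) I (param I p.2) q.2).comp
        (mfderiv 𝓘(ℝ, ℝ × E) 𝓘(ℝ, E) (Prod.snd : ℝ × E → E) q) :=
    mfderiv_comp (I' := 𝓘(ℝ, E)) q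
      ((contMDiffAt_param (mem_target_of_mem_target_cone hq)).mdifferentiableAt (by simp))
      (by rw [mdifferentiableAt_iff_differentiableAt]; exact differentiableAt_snd)
  have h₃ : ∀ f : ℝ × E → M, f = (fun q ↦ param I p.2 q.2) →
      (mfderiv 𝓘(ℝ, ℝ × E) I f q A : E) =
        mfderiv 𝓘(ℝ, ℝ × E) I (fun q : ℝ × E ↦ param I p.2 q.2) q A := by
    rintro _ rfl
    rfl
  rw [mfderiv_eq_fderiv, fderiv_snd] at h₂
  exact (DFunLike.congr_fun h₁ A).symm.trans
    ((h₃ _ (funext (snd_param_cone p))).trans (DFunLike.congr_fun h₂ A))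

theorem dt_mfderiv_param_cone (p : Cone M) :
    ∀ᶠ q in nhds (extChartAt (coneModel I) p p), ∀ A : ℝ × E,
      dt I (param (coneModel I) p q)
        (mfderiv 𝓘(ℝ, ℝ × E) (coneModel I) (param (coneModel I) p) q A) = A.1 := by
  -- The equality of radii is needed around each nearby `q`, since it gets differentiated there.
  filter_upwards [(radius_param_cone (I := I) p).eventually_nhds,
    (isOpen_extChartAt_target p).mem_nhds (mem_extChartAt_target (I := coneModel I) p)]
    with q hq hq' A
  have hr : MDifferentiableAt (coneModel I) 𝓘(ℝ, ℝ) (radius (M := M))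
      (param (coneModel I) p q) := by
    have : ContMDiff (coneModel I) 𝓘(ℝ, ℝ) 1 (radius (M := M)) :=
      contMDiff_subtype_val.comp contMDiff_fst
    exact this.mdifferentiable (by simp) _
  have h₁ : mfderiv 𝓘(ℝ, ℝ × E) 𝓘(ℝ, ℝ) (fun q ↦ radius (param (coneModel I) p q)) q =
      (dt I (param (coneModel I) p q)).comp
        (mfderiv 𝓘(ℝ, ℝ × E) (coneModel I) (param (coneModel I) p) q) := by
    rw [← mfderiv_radius]
    exact mfderiv_comp q hr ((contMDiffAt_param hq').mdifferentiableAt (by simp))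
  rw [mfderiv_eq_fderiv, Filter.EventuallyEq.fderiv_eq hq, fderiv_fst] at h₁
  exact (DFunLike.congr_fun h₁ A).symm

theorem metricInChart_coneMetric
    (g : Π x : M, TangentSpace I x →L[ℝ] TangentSpace I x →L[ℝ] ℝ) (p : Cone M) :
    metricInChart (coneModel I) (coneMetric I g) p =ᶠ[nhds (extChartAt (coneModel I) p p)]
      localCone (metricInChart I g p.2) := by
  filter_upwards [radius_param_cone (I := I) p, dt_mfderiv_param_cone (I := I) p,
    (isOpen_extChartAt_target p).mem_nhds (mem_extChartAt_target (I := coneModel I) p)]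
    with q h₁ h₂ h₃
  refine ContinuousLinearMap.ext fun A ↦ ContinuousLinearMap.ext fun B ↦ ?_
  have h : ∀ y : M, y = param I p.2 q.2 → ∀ v w : E, g y v w = g (param I p.2 q.2) v w :=
    fun y hy ↦ by subst hy; simp
  refine (congrArg₂ (· + ·) (congrArg₂ (· * ·) (h₂ A) (h₂ B))
    (congrArg₂ (· * ·) (congrArg (· ^ 2) h₁) ?_)).trans (localCone_apply _ q A B).symm
  exact (congrArg₂ (fun v w : E ↦ g (param (coneModel I) p q).2 v w)
    (proj_mfderiv_param_cone h₃ A) (proj_mfderiv_param_cone h₃ B)).trans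
    (h _ (snd_param_cone p q) _ _)

theorem snd_inverse_chartFrame_cone (p : Cone M) (A : TangentSpace (coneModel I) p) :
    ((chartFrame (coneModel I) p).inverse A).2 = (chartFrame I p.2).inverse (proj I p A) := by
  have h := proj_mfderiv_param_cone (mem_extChartAt_target (I := coneModel I) p)
    ((chartFrame (coneModel I) p).inverse A)
  have h' : (proj I p (chartFrame (coneModel I) p ((chartFrame (coneModel I) p).inverse A)) : E) =
      chartFrame I p.2 ((chartFrame (coneModel I) p).inverse A).2 := h
  rw [(isInvertible_chartFrame p).self_apply_inverse] at h'
  rw [h', (isInvertible_chartFrame p.2).inverse_apply_self]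

variable [FiniteDimensional ℝ E]

theorem riemann_eq
    (g : Bundle.ContMDiffRiemannianMetric I ∞ E (fun x : M ↦ TangentSpace I x))
    {X Y Z : Π x : M, TangentSpace I x} (W : Π x : M, TangentSpace I x) (x : M)
    (hX : IsSmoothField I X) (hY : IsSmoothField I Y) (hZ : IsSmoothField I Z) :
    riemann I g.inner X Y Z W x = curvForm I g.inner x (X x) (Y x) (Z x) (W x) :=
  have := FiniteDimensional.complete ℝ E
  riemann_eq_curvForm W
    ((contDiffAt_metricInChart g (mem_extChartAt_target x)).of_le (WithTop.coe_le_coe.2 le_top))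
    (isInvertible_metricInChart g (mem_extChartAt_target x)) hX hY hZ

/-- The curvature form of the cone metric. -/
theorem riemann_coneMetric
    (g : Bundle.ContMDiffRiemannianMetric I ∞ E (fun x : M ↦ TangentSpace I x))
    {A B C : Π p : Cone M, TangentSpace (coneModel I) p}
    (D : Π p : Cone M, TangentSpace (coneModel I) p) (p : Cone M)
    (hA : IsSmoothField (coneModel I) A) (hB : IsSmoothField (coneModel I) B)
    (hC : IsSmoothField (coneModel I) C) :
    riemann (coneModel I) (coneMetric I g.inner) A B C D p =
      radius p ^ 2 * coneForm I g.inner p.2 (proj I p (A p)) (proj I p (B p)) (proj I p (C p))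
        (proj I p (D p)) := by
  have := FiniteDimensional.complete ℝ E
  have heq := metricInChart_coneMetric g.inner p
  have hp : (extChartAt (coneModel I) p p).1 ≠ 0 := by
    rw [extChartAt_cone]
    exact (Set.mem_Ioi.1 p.1.2).ne'
  have hmem : (extChartAt (coneModel I) p p).2 ∈ (extChartAt I p.2).target :=
    mem_target_of_mem_target_cone (mem_extChartAt_target p)
  have hG : ContDiffAt ℝ 2 (metricInChart I g.inner p.2) (extChartAt (coneModel I) p p).2 :=
    (contDiffAt_metricInChart g hmem).of_le (WithTop.coe_le_coe.2 le_top)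
  have hu : ∀ᶠ v in nhds (extChartAt (coneModel I) p p).2,
      (metricInChart I g.inner p.2 v).IsInvertible := by
    filter_upwards [(isOpen_extChartAt_target p.2).mem_nhds hmem] with v hv
    exact isInvertible_metricInChart g hv
  rw [riemann_eq_curvForm D ((contDiffAt_localCone hG).congr_of_eventuallyEq heq)
    (heq.eq_of_nhds ▸ isInvertible_localCone hp hu.self_of_nhds) hA hB hC]
  have h := isInvertible_chartFrame (I := coneModel I) p
  simp only [coneForm, curvForm]
  -- With `D p` written as the frame applied to its coordinates, the pairing becomes the metric in
  -- the chart, which can be replaced by `localCone`.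
  conv_lhs => rw [← h.self_apply_inverse (D p)]
  rw [← metricInChart_extChartAt, curvTensor_congr heq, heq.eq_of_nhds,
    curvTensor_localCone hp hG hu
      (Filter.Eventually.of_forall fun v ↦ metricInChart_symm g p.2 v), localCone_apply]
  simp only [snd_inverse_chartFrame_cone, extChartAt_cone, metricInChart_extChartAt]
  have h' := fun a ↦ (isInvertible_chartFrame (I := I) p.2).self_apply_inverse a
  simp only [map_add, map_sub, map_smul, h', radius, add_apply, sub_apply, smul_apply, smul_eq_mul]
  ring

end ConeCurvature

/-! ### Smooth fields on the cone and the action of `J`. -/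

section ConeFields

variable {E : Type*} [NormedAddCommGroup E] [NormedSpace ℝ E]
  {H : Type*} [TopologicalSpace H] {I : ModelWithCorners ℝ E H}
  {M : Type*} [TopologicalSpace M] [ChartedSpace H M]

/-- All charts of `PosLine` restrict the identity of `ℝ`, so the coordinate changes have derivative
`1`. -/
theorem trivializationAt_posLine (s₀ s : PosLine) (a : ℝ) :
    (trivializationAt ℝ (TangentSpace 𝓘(ℝ, ℝ)) s₀ (⟨s, a⟩ : TangentBundle 𝓘(ℝ, ℝ) PosLine)).2
      = a := by
  rw [TangentBundle.trivializationAt_apply]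
  have h : ((chartAt ℝ s₀).extend 𝓘(ℝ, ℝ) ∘ ((chartAt ℝ s).extend 𝓘(ℝ, ℝ)).symm)
      =ᶠ[nhds (s : ℝ)] id :=
    (TopologicalSpace.Opens.chartAt_subtype_val_symm_eventuallyEq (H := ℝ) PosLine
      (x := s)).symm
  have h' : fderiv ℝ ((chartAt ℝ s₀).extend 𝓘(ℝ, ℝ) ∘ ((chartAt ℝ s).extend 𝓘(ℝ, ℝ)).symm)
      (s : ℝ) = ContinuousLinearMap.id ℝ ℝ := by
    rw [h.fderiv_eq, fderiv_id]
  rw [ModelWithCorners.range_eq_univ, fderivWithin_univ]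
  exact DFunLike.congr_fun h' a

theorem contMDiff_radius : ContMDiff (coneModel I) 𝓘(ℝ, ℝ) ∞ (radius (M := M)) :=
  contMDiff_subtype_val.comp contMDiff_fst

variable [IsManifold I ∞ M]

/-- Fields along a smooth map `b` may be combined with smooth coefficients. -/
theorem contMDiff_sub_smul_along {E' H' N : Type*} [NormedAddCommGroup E'] [NormedSpace ℝ E']
    [TopologicalSpace H'] {J : ModelWithCorners ℝ E' H'} [TopologicalSpace N] [ChartedSpace H' N]
    {b : N → M} {f : N → ℝ} {σ τ : Π p : N, TangentSpace I (b p)}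
    (hf : ContMDiff J 𝓘(ℝ, ℝ) ∞ f)
    (hσ : ContMDiff J I.tangent ∞ (fun p ↦ (⟨b p, σ p⟩ : TangentBundle I M)))
    (hτ : ContMDiff J I.tangent ∞ (fun p ↦ (⟨b p, τ p⟩ : TangentBundle I M))) :
    ContMDiff J I.tangent ∞ (fun p ↦ (⟨b p, σ p - f p • τ p⟩ : TangentBundle I M)) := by
  have := IsManifold.of_le (I := I) (M := M) (m := 1) (n := ∞) (by simp)
  intro p
  have h₁ := Bundle.contMDiffAt_totalSpace.1 (hσ p)
  have h₂ := Bundle.contMDiffAt_totalSpace.1 (hτ p)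
  refine Bundle.contMDiffAt_totalSpace.2 ⟨h₁.1, ?_⟩
  refine (h₁.2.sub ((hf p).smul h₂.2)).congr_of_eventuallyEq ?_
  set e := trivializationAt E (TangentSpace I) (b p)
  have hb : ∀ᶠ q in nhds p, b q ∈ e.baseSet :=
    h₁.1.continuousAt.eventually
      (e.open_baseSet.mem_nhds (FiberBundle.mem_baseSet_trivializationAt' (b p)))
  filter_upwards [hb] with q hq
  have hl := e.linear ℝ hq
  exact (hl.map_sub _ _).trans (congrArg _ (hl.map_smul _ _))

theorem isSmoothField_mkTangent {f : Cone M → ℝ} {σ : Π p : Cone M, TangentSpace I p.2}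
    (hf : ContMDiff (coneModel I) 𝓘(ℝ, ℝ) ∞ f)
    (hσ : ContMDiff (coneModel I) I.tangent ∞ (fun p : Cone M ↦ (⟨p.2, σ p⟩ : TangentBundle I M))) :
    IsSmoothField (coneModel I) (fun p : Cone M ↦ mkTangent I p (f p, σ p)) := by
  have := IsManifold.of_le (I := I) (M := M) (m := 1) (n := ∞) (by simp)
  have h : ContMDiff (coneModel I) 𝓘(ℝ, ℝ).tangent ∞
      (fun p : Cone M ↦ (⟨p.1, f p⟩ : TangentBundle 𝓘(ℝ, ℝ) PosLine)) := by
    intro p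
    refine (Bundle.contMDiffAt_totalSpace).2 ⟨contMDiffAt_fst, ?_⟩
    exact (hf p).congr_of_eventuallyEq
      (Filter.Eventually.of_forall fun q ↦ trivializationAt_posLine p.1 q.1 (f q))
  exact contMDiff_equivTangentBundleProd_symm.comp (h.prodMk hσ)

/-- The `M`-component is the tangent map of `Prod.snd` composed with the field. -/
theorem contMDiff_proj {A : Π p : Cone M, TangentSpace (coneModel I) p}
    (hA : IsSmoothField (coneModel I) A) :
    ContMDiff (coneModel I) I.tangent ∞
      (fun p : Cone M ↦ (⟨p.2, proj I p (A p)⟩ : TangentBundle I M)) := by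
  have := IsManifold.of_le (I := I) (M := M) (m := 1) (n := ∞) (by simp)
  have h : ContMDiff (coneModel I).tangent I.tangent ∞
      (tangentMap (coneModel I) I (Prod.snd : Cone M → M)) :=
    contMDiff_snd.contMDiff_tangentMap (n := ∞) (by simp)
  have h' := h.comp hA
  refine h'.congr fun p ↦ ?_
  simp only [Function.comp_apply, tangentMap, mfderiv_snd_cone]

theorem contMDiff_dt {A : Π p : Cone M, TangentSpace (coneModel I) p}
    (hA : IsSmoothField (coneModel I) A) :
    ContMDiff (coneModel I) 𝓘(ℝ, ℝ) ∞ (fun p : Cone M ↦ dt I p (A p)) := by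
  have := IsManifold.of_le (I := I) (M := M) (m := 1) (n := ∞) (by simp)
  have h : ContMDiff (coneModel I).tangent 𝓘(ℝ, ℝ).tangent ∞
      (tangentMap (coneModel I) 𝓘(ℝ, ℝ) (radius (M := M))) :=
    contMDiff_radius.contMDiff_tangentMap (n := ∞) (by simp)
  intro p
  have h' := ((Bundle.contMDiffAt_totalSpace).1 (h.comp hA p)).2
  refine h'.congr_of_eventuallyEq (Filter.Eventually.of_forall fun q ↦ ?_)
  simp [tangentMap, mfderiv_radius]
  rfl

/-- The restriction to a slice `{t} × M` of the `M`-component of a field on the cone. -/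
theorem isSmoothField_slice {A : Π p : Cone M, TangentSpace (coneModel I) p}
    (hA : IsSmoothField (coneModel I) A) (t : PosLine) :
    IsSmoothField I (fun x ↦ proj I (t, x) (A (t, x))) :=
  (contMDiff_proj hA).comp (contMDiff_const.prodMk contMDiff_id)

namespace AlmostContactMetric

variable (S : AlmostContactMetric I M)

theorem isSmoothField_φ {X : Π x : M, TangentSpace I x} (hX : IsSmoothField I X) :
    IsSmoothField I (fun x ↦ S.φ x (X x)) :=
  ContMDiff.clm_bundle_apply (F₁ := E) (F₂ := E) S.contMDiff_φ hX

theorem isSmoothField_coneJ {A : Π p : Cone M, TangentSpace (coneModel I) p}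
    (hA : IsSmoothField (coneModel I) A) :
    IsSmoothField (coneModel I) (fun p ↦ S.coneJ p (A p)) := by
  have hP := contMDiff_proj hA
  simp only [coneJ_apply]
  refine isSmoothField_mkTangent (σ := fun p ↦ S.φ p.2 (proj I p (A p)) -
    (dt I p (A p) / radius p) • S.ξ p.2) (contMDiff_radius.mul ?_) ?_
  · have h : ContMDiff (coneModel I) (I.prod 𝓘(ℝ)) ∞
        (fun p ↦ Bundle.TotalSpace.mk' ℝ (E := Bundle.Trivial M ℝ) p.2
          (S.η p.2 (proj I p (A p)))) :=
      ContMDiff.clm_bundle_apply (F₁ := E) (F₂ := ℝ) (S.contMDiff_η.comp contMDiff_snd) hP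
    intro p
    exact ((Bundle.contMDiffAt_totalSpace).1 (h p)).2
  · refine contMDiff_sub_smul_along ?_ ?_ (S.contMDiff_ξ.comp contMDiff_snd)
    · exact (contMDiff_dt hA).div₀ contMDiff_radius fun p ↦ (Set.mem_Ioi.1 p.1.2).ne'
    · exact ContMDiff.clm_bundle_apply (F₁ := E) (F₂ := E) (S.contMDiff_φ.comp contMDiff_snd) hP

theorem proj_coneJ (p : Cone M) (v : TangentSpace (coneModel I) p) :
    proj I p (S.coneJ p v) = S.φ p.2 (proj I p v) - (dt I p v / radius p) • S.ξ p.2 := by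
  rw [coneJ_apply]
  rfl

theorem φ_ξ (x : M) : S.φ x (S.ξ x) = 0 := by
  -- As `φ²ξ = 0`, the formula for `φ²` at `φξ` gives `φξ = c ξ` with `c = η(φξ)`; then `c² = η(φ²ξ)
  -- = 0`.
  have h₁ : S.φ x (S.φ x (S.ξ x)) = 0 := by simp [S.φ_φ, S.η_ξ]
  have h₂ : S.φ x (S.ξ x) = S.η x (S.φ x (S.ξ x)) • S.ξ x := by
    have h := S.φ_φ x (S.φ x (S.ξ x))
    rw [h₁, map_zero] at h
    exact (neg_add_eq_zero.1 h.symm)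
  have h₃ : S.η x (S.φ x (S.ξ x)) = 0 := by
    have h := congrArg (S.η x) h₁
    rw [h₂, map_smul, map_smul, map_zero, smul_eq_mul] at h
    exact mul_self_eq_zero.1 (by simpa using h)
  rw [h₂, h₃, zero_smul]

/-- The pointwise form of the identity characterizing `(K3)` on the cone: the curvature form of the
cone is invariant under `φ`. -/
theorem coneForm_φ_iff (x : M) (a b c d : TangentSpace I x) :
    coneForm I S.g.inner x a b c d =
        coneForm I S.g.inner x (S.φ x a) (S.φ x b) (S.φ x c) (S.φ x d) ↔
      curvForm I S.g.inner x a b c d =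
        curvForm I S.g.inner x (S.φ x a) (S.φ x b) (S.φ x c) (S.φ x d)
          + S.g.inner x a c * S.η x d * S.η x b - S.g.inner x c b * S.η x a * S.η x d
          + S.g.inner x b d * S.η x a * S.η x c - S.g.inner x a d * S.η x b * S.η x c := by
  simp only [coneForm, S.g_φ_φ, S.g.symm x c b]
  constructor <;> intro h <;> linear_combination h

theorem isSmoothField_φ_sub_smul_ξ {X : Π x : M, TangentSpace I x} (hX : IsSmoothField I X)
    (r : ℝ) : IsSmoothField I (fun x ↦ S.φ x (X x) - r • S.ξ x) :=
  contMDiff_sub_smul_along (b := fun x : M ↦ x) contMDiff_const (S.isSmoothField_φ hX) S.contMDiff_ξ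

/-- If the curvature form of the cone is invariant under `φ`, it is annihilated by `ξ`, and
therefore does not see the `ξ`-components of its arguments. -/
theorem coneForm_sub_smul_ξ
    (h : ∀ X Y Z W : Π x : M, TangentSpace I x,
      IsSmoothField I X → IsSmoothField I Y → IsSmoothField I Z → IsSmoothField I W →
      ∀ x : M, coneForm I S.g.inner x (X x) (Y x) (Z x) (W x) =
        coneForm I S.g.inner x (S.φ x (X x)) (S.φ x (Y x)) (S.φ x (Z x)) (S.φ x (W x)))
    {X Y Z W : Π x : M, TangentSpace I x} (hX : IsSmoothField I X) (hY : IsSmoothField I Y)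
    (hZ : IsSmoothField I Z) (hW : IsSmoothField I W) (r₁ r₂ r₃ r₄ : ℝ) (x : M) :
    coneForm I S.g.inner x (S.φ x (X x) - r₁ • S.ξ x) (S.φ x (Y x) - r₂ • S.ξ x)
        (S.φ x (Z x) - r₃ • S.ξ x) (S.φ x (W x) - r₄ • S.ξ x) =
      coneForm I S.g.inner x (X x) (Y x) (Z x) (W x) := by
  have hφX := S.isSmoothField_φ hX
  have hφY := S.isSmoothField_φ hY
  have hφZ := S.isSmoothField_φ hZ
  have hY' := S.isSmoothField_φ_sub_smul_ξ hY r₂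
  have hZ' := S.isSmoothField_φ_sub_smul_ξ hZ r₃
  have hW' := S.isSmoothField_φ_sub_smul_ξ hW r₄
  -- With `ξ` in a slot, the invariant value contains `φξ = 0`. The slots are cleared from left to
  -- right: those before `ξ` are already reduced to `φ` of the field, those after it still carry
  -- their `ξ`-terms.
  have h₁ := h _ _ _ _ S.contMDiff_ξ hY' hZ' hW' x
  have h₂ := h _ _ _ _ hφX S.contMDiff_ξ hZ' hW' x
  have h₃ := h _ _ _ _ hφX hφY S.contMDiff_ξ hW' x
  have h₄ := h _ _ _ _ hφX hφY hφZ S.contMDiff_ξ x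
  simp only [φ_ξ, coneForm_zero₁] at h₁
  simp only [φ_ξ, coneForm_zero₂] at h₂
  simp only [φ_ξ, coneForm_zero₃] at h₃
  simp only [φ_ξ, coneForm_zero₄] at h₄
  rw [coneForm_sub_smul₁, h₁, coneForm_sub_smul₂, h₂, coneForm_sub_smul₃, h₃, coneForm_sub_smul₄,
    h₄, h X Y Z W hX hY hZ hW x]
  ring

end AlmostContactMetric

end ConeFields
end Gray

/-! ### The equivalence of (K3) on the cone and (G3) on the base. -/

open Gray in
theorem mainTheorem3 {E : Type*} [NormedAddCommGroup E] [NormedSpace ℝ E] [FiniteDimensional ℝ E]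
    {H : Type*} [TopologicalSpace H] (I : ModelWithCorners ℝ E H) [I.Boundaryless]
    {M : Type*} [TopologicalSpace M] [ChartedSpace H M] [IsManifold I ∞ M]
    (S : AlmostContactMetric I M) :
    IsK3 (coneModel I) (coneMetric I S.g.inner) S.coneJ ↔
      ∀ X Y Z W : Π x : M, TangentSpace I x,
        IsSmoothField I X → IsSmoothField I Y → IsSmoothField I Z → IsSmoothField I W →
        ∀ x : M, riemann I S.g.inner X Y Z W x =
          riemann I S.g.inner (fun y ↦ S.φ y (X y)) (fun y ↦ S.φ y (Y y)) (fun y ↦ S.φ y (Z y))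
              (fun y ↦ S.φ y (W y)) x
            + S.g.inner x (X x) (Z x) * S.η x (W x) * S.η x (Y x)
            - S.g.inner x (Z x) (Y x) * S.η x (X x) * S.η x (W x)
            + S.g.inner x (Y x) (W x) * S.η x (X x) * S.η x (Z x)
            - S.g.inner x (X x) (W x) * S.η x (Y x) * S.η x (Z x) := by
  constructor
  · intro hK X Y Z W hX hY hZ hW x
    have hlift {X : Π x : M, TangentSpace I x} (hX : IsSmoothField I X) :
        IsSmoothField (coneModel I) (fun p : Cone M ↦ mkTangent I p (0, X p.2)) :=
      isSmoothField_mkTangent (f := fun _ ↦ 0) (σ := fun p ↦ X p.2) contMDiff_const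
        (hX.comp contMDiff_snd)
    -- At level `t = 1` the factor `t²` is `1`; the lifts have no radial part, so `J` acts on their
    -- `M`-components as `φ`.
    have h := hK _ _ _ _ (hlift hX) (hlift hY) (hlift hZ) (hlift hW) (⟨1, Set.mem_Ioi.2 one_pos⟩, x)
    rw [riemann_coneMetric S.g _ _ (hlift hX) (hlift hY) (hlift hZ),
      riemann_coneMetric S.g _ _ (S.isSmoothField_coneJ (hlift hX))
        (S.isSmoothField_coneJ (hlift hY)) (S.isSmoothField_coneJ (hlift hZ))] at h
    rw [riemann_eq S.g _ _ hX hY hZ, riemann_eq S.g _ _ (S.isSmoothField_φ hX)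
      (S.isSmoothField_φ hY) (S.isSmoothField_φ hZ), ← S.coneForm_φ_iff]
    have hJ (p : Cone M) (v : TangentSpace I p.2) :
        proj I p (S.coneJ p (mkTangent I p (0, v))) = S.φ p.2 v := by
      have hdt : dt I p (mkTangent I p (0, v)) = 0 := rfl
      rw [S.proj_coneJ, hdt, zero_div, zero_smul, sub_zero]
      rfl
    rw [hJ, hJ, hJ, hJ] at h
    exact mul_left_cancel₀ (pow_ne_zero 2 one_ne_zero) h
  · intro hG A B C D hA hB hC hD p
    rw [riemann_coneMetric S.g _ _ hA hB hC,
      riemann_coneMetric S.g _ _ (S.isSmoothField_coneJ hA)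
        (S.isSmoothField_coneJ hB) (S.isSmoothField_coneJ hC)]
    simp only [AlmostContactMetric.proj_coneJ]
    -- Restricting to the slice through `p` gives fields on `M` with the right values at `p.2`; the
    -- constants `r₁`, …, `r₄` are the numbers `a / t` at `p`.
    refine congrArg _ (S.coneForm_sub_smul_ξ (fun X Y Z W hX hY hZ hW x ↦ ?_)
      (isSmoothField_slice hA p.1) (isSmoothField_slice hB p.1) (isSmoothField_slice hC p.1)
      (isSmoothField_slice hD p.1) _ _ _ _ p.2).symm
    have h := hG X Y Z W hX hY hZ hW x
    rwa [riemann_eq S.g _ _ hX hY hZ, riemann_eq S.g _ _ (S.isSmoothField_φ hX)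
      (S.isSmoothField_φ hY) (S.isSmoothField_φ hZ), ← S.coneForm_φ_iff] at h
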